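/- Let $\mathbb{X}=(X_n)_{n\ge 1}$ be a strictly stationary and ergodic sequence of real random variables on a probability space $(\Omega,\mathcal F,\mathbb P)$, let $V$ be an almost surely positive random variable on the same space, and put $S_n=V\cdot X_n$, $n\ge 1$, where the sequence $\mathbb{S}=(S_n)_{n\ge 1}$ is assumed to be strictly stationary (this holds, for instance, when $V$ is independent of $\mathbb{X}$). Let $a>0$ and let $(k_n)_{n\ge1}$ be integers with $1\le k_n\le n$ for all $n\ge 1$ and $k_n/n\to 1$. For $n\ge 1$ let $S_{1:n}\le\dots\le S_{n:n}$ be the order statistics of $S_1,\dots,S_n$ and $$K^{\mathbb S}(k_n,n,a)=\#\{1\le i\le n:\ S_{k_n:n}-a<S_i<S_{k_n:n}\},$$ with the convention that this number is $0$ for $n=0$. Let $\gamma_1^{X_1}=\sup\{x\in\mathbb R:\ \mathbb P(X_1\le x)<1\}$, and let $\mathcal I^{\mathbb S}$ be the sigma-field of all events $A$ for which there is a Borel set $B\subseteq\mathbb R^{\mathbb N}$ with $A=\{\omega:(S_i(\omega),S_{i+1}(\omega),\dots)\in B\}$ for every $i\ge 1$. Assume that $\gamma_1^{X_1}<\infty$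 and $$\mathbb P(X_1=\gamma_1^{X_1})=\mathbb P\Big(X_1+\frac aV=\gamma_1^{X_1}\Big)=0 .$$ Put $L=\mathbb P\big(X_1+\frac aV>\gamma_1^{X_1}\,\big|\,\mathcal I^{\mathbb S}\big)$. Then $$\frac{K^{\mathbb S}(k_n,n,a)}{n}\longrightarrow L\quad\text{almost surely as }n\to\infty .$$ Moreover, let $(N(t))_{t\ge0}$ be non-negative integer-valued random variables, $Z$ an almost surely positive random variable (all on $(\Omega,\mathcal F,\mathbb P)$), $c:[0,\infty)\to\mathbb R$ a function with $c(t)>0$ for $t>0$ and $c(t)\to\infty$ as $t\to\infty$, and put $\mathcal K^{\mathbb S}_t=K^{\mathbb S}(k_{N(t)},N(t),a)$. Then, as $t\to\infty$: * if $N(t)/c(t)\to Z$ almost surely, then $\mathcal K^{\mathbb S}_t/c(t)\to Z\cdot L$ almost surely; * if $N(t)/c(t)\to Z$ in probability, then $\mathcal K^{\mathbb S}_t/c(t)\to Z\cdot L$ in probability; * if $N(t)/c(t)\to Z$ in distribution and $L$ is degenerate (almost surely constant), then $\mathcal K^{\mathbb S}_t/c(t)\to Z\cdot L$ in distribution. 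-/

import Mathlib

open MeasureTheory ProbabilityTheory Filter Topology
open scoped NNReal

/-- The left shift `(x₁, x₂, …) ↦ (x₂, x₃, …)` on real sequences. Sequences are indexed by `ℕ`
starting from `0`, so the term `x₁` of the mathematical notation is `x 0`. -/
def seqShift (x : ℕ → ℝ) : ℕ → ℝ := fun n => x (n + 1)

/-- The law on `ℝ^ℕ` of a sequence `X` of random variables. -/
noncomputable def seqLaw {Ω : Type*} [MeasurableSpace Ω] (P : Measure Ω) (X : ℕ → Ω → ℝ) :
    Measure (ℕ → ℝ) :=
  P.map (fun ω n => X n ω)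

/-- Strict stationarity: the law of the sequence is invariant under the shift. -/
def IsStrictlyStationary {Ω : Type*} [MeasurableSpace Ω] (P : Measure Ω) (X : ℕ → Ω → ℝ) : Prop :=
  MeasurePreserving seqShift (seqLaw P X) (seqLaw P X)

/-- Strict stationarity together with ergodicity: the shift is an ergodic (in particular measure
preserving) transformation for the law of the sequence. -/
def IsStationaryErgodic {Ω : Type*} [MeasurableSpace Ω] (P : Measure Ω) (X : ℕ → Ω → ℝ) : Prop :=
  Ergodic seqShift (seqLaw P X)

/-- The sigma-field of the events invariant with respect to the sequence `X`: the sets `A` for which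
there is a Borel set `B ⊆ ℝ^ℕ` with `A = {ω | (X i ω, X (i + 1) ω, …) ∈ B}` for every `i`. -/
def invariantSigma {Ω : Type*} (X : ℕ → Ω → ℝ) : MeasurableSpace Ω where
  MeasurableSet' A := ∃ B : Set (ℕ → ℝ), MeasurableSet B ∧
    ∀ i : ℕ, A = {ω | (fun n => X (i + n) ω) ∈ B}
  measurableSet_empty := ⟨∅, MeasurableSet.empty, fun _ => by simp⟩
  measurableSet_compl := by
    rintro A ⟨B, hB, h⟩
    refine ⟨Bᶜ, hB.compl, fun i => ?_⟩
    rw [h i]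
    rfl
  measurableSet_iUnion := by
    intro A hA
    choose B hB h using hA
    refine ⟨⋃ j, B j, MeasurableSet.iUnion hB, fun i => ?_⟩
    ext ω
    simp only [Set.mem_iUnion, Set.mem_setOf_eq]
    exact exists_congr fun j => by rw [h j i]; rfl

/-- The right endpoint `sup {x ∈ ℝ | F x < 1}` of the support of a random variable with
distribution function `F`, as an extended real number. -/
noncomputable def rightEndpoint {Ω : Type*} [MeasurableSpace Ω] (P : Measure Ω) (Y : Ω → ℝ) :
    EReal :=
  sSup ((fun x : ℝ => (x : EReal)) '' {x : ℝ | cdf (P.map Y) x < 1})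

/-- The order statistic `x_{k:n}`: the `k`-th smallest of the first `n` terms `x 0, …, x (n - 1)`,
for `1 ≤ k ≤ n` (with the value `0` for other `k`, which is never used). -/
noncomputable def orderStat (x : ℕ → ℝ) (k n : ℕ) : ℝ :=
  if h : 1 ≤ k ∧ k ≤ n then
    x (Tuple.sort (fun i : Fin n => x i) ⟨k - 1, by omega⟩)
  else 0

/-- `K(k, n, a)`: the number of the first `n` terms lying in the open interval
`(x_{k:n} - a, x_{k:n})`. It is `0` for `n = 0`. -/
noncomputable def nearCount (x : ℕ → ℝ) (k n : ℕ) (a : ℝ) : ℕ :=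
  ((Finset.range n).filter
    fun i => orderStat x k n - a < x i ∧ x i < orderStat x k n).card

/-- A random variable is degenerate if it is almost surely constant. -/
def IsDegenerate {Ω : Type*} [MeasurableSpace Ω] (P : Measure Ω) (Y : Ω → ℝ) : Prop :=
  ∃ q : ℝ, ∀ᵐ ω ∂P, Y ω = q

/-- The conditional probability `P(X₁ + a / V > γ | 𝓘^S)`, where `γ` is the right endpoint of the
support of `X₁` and `𝓘^S` is the sigma-field of the events invariant with respect to the
sequence `S = (V X₁, V X₂, …)`. -/
noncomputable def scaledLimit {Ω : Type*} [MeasurableSpace Ω] (P : Measure Ω) (X : ℕ → Ω → ℝ)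
    (V : Ω → ℝ) (a : ℝ) : Ω → ℝ :=
  P[Set.indicator {ω | rightEndpoint P (X 0) < ((X 0 ω + a / V ω : ℝ) : EReal)}
    (fun _ => (1 : ℝ)) | invariantSigma (fun n ω => V ω * X n ω)]

/-!
Let `ν` be the law of `X₁`, `γ` its right endpoint and `b = a / V`. Scaling by `V` turns the count
for `S` and `a` into the count for `X` and `b`. By the pointwise ergodic theorem the empirical tails
of `X` converge to those of `ν`. As `γ` is not an atom of `ν`, the order statistics tend to `γ`
without accumulating mass there, and the proportion of near points converges to `ν (γ - b, ∞)`
provided that `γ - b` is not an atom either. To identify this limit, note that the supremum of every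
tail of `S` is `V γ`, so that `{Xᵢ + a / V > γ}` is the event that the `i`-th shift of `S` has its
first term within `a` of its supremum. The Birkhoff averages of this event, which have conditional
expectation `L` by stationarity of `S`, also converge to `ν (γ - b, ∞)`.

For a random index, `K (N t) / c t = (N t / c t) * (K (N t) / N t)`, and `N t → ∞` because `Z > 0`.
Convergence in probability reduces to almost sure convergence along subsequences, and convergence
in distribution follows from Slutsky's theorem.
-/

section PointwiseErgodicTheorem

variable {α : Type*}

/-- The maximum of the Birkhoff sums of lengths `0, …, n`, the maximal function in the proof of the
pointwise ergodic theorem. The empty sum is included, so that it is nonnegative. -/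
noncomputable def maxBirkhoffSum (T : α → α) (g : α → ℝ) (n : ℕ) (x : α) : ℝ :=
  partialSups (fun m => birkhoffSum T g m x) n

theorem monotone_maxBirkhoffSum (T : α → α) (g : α → ℝ) (x : α) :
    Monotone fun n => maxBirkhoffSum T g n x :=
  partialSups_monotone _

theorem birkhoffSum_le_maxBirkhoffSum (T : α → α) (g : α → ℝ) (n : ℕ) (x : α) :
    birkhoffSum T g n x ≤ maxBirkhoffSum T g n x :=
  le_partialSups (fun m => birkhoffSum T g m x) n

theorem maxBirkhoffSum_nonneg (T : α → α) (g : α → ℝ) (n : ℕ) (x : α) :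
    0 ≤ maxBirkhoffSum T g n x :=
  le_partialSups_of_le (fun m => birkhoffSum T g m x) n.zero_le

theorem maxBirkhoffSum_succ (T : α → α) (g : α → ℝ) (n : ℕ) (x : α) :
    maxBirkhoffSum T g (n + 1) x = max 0 (g x + maxBirkhoffSum T g n (T x)) := by
  induction n with
  | zero =>
    rw [maxBirkhoffSum, partialSups_add_one]
    simp [maxBirkhoffSum]
  | succ n ih =>
    rw [maxBirkhoffSum, partialSups_add_one, ← maxBirkhoffSum, ih, birkhoffSum_succ', max_assoc,
      max_add_add_left, maxBirkhoffSum, maxBirkhoffSum, partialSups_add_one]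

theorem maxBirkhoffSum_succ_sub_comp (T : α → α) (g : α → ℝ) (n : ℕ) (x : α) :
    maxBirkhoffSum T g (n + 1) x - maxBirkhoffSum T g n (T x) =
      max (-maxBirkhoffSum T g n (T x)) (g x) := by
  rw [maxBirkhoffSum_succ, ← max_sub_sub_right, zero_sub, add_sub_cancel_right]

theorem bddAbove_range_birkhoffSum_comp_iff (T : α → α) (g : α → ℝ) (x : α) :
    BddAbove (Set.range fun n => birkhoffSum T g n (T x)) ↔
      BddAbove (Set.range fun n => birkhoffSum T g n x) := by
  simp only [bddAbove_def, Set.forall_mem_range]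
  constructor
  · rintro ⟨C, hC⟩
    refine ⟨max 0 (g x + C), fun n => ?_⟩
    cases n with
    | zero => exact le_max_left _ _
    | succ n =>
      rw [birkhoffSum_succ']
      exact le_max_of_le_right (add_le_add_right (hC n) _)
  · rintro ⟨C, hC⟩
    refine ⟨C - g x, fun n => ?_⟩
    have := hC (n + 1)
    rw [birkhoffSum_succ'] at this
    linarith

variable [MeasurableSpace α] {μ : Measure α} {T : α → α} {g : α → ℝ}

theorem measurable_birkhoffSum (hT : Measurable T) (hg : Measurable g) (n : ℕ) :
    Measurable (birkhoffSum T g n) :=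
  Finset.measurable_sum _ fun i _ => hg.comp (hT.iterate i)

theorem integrable_maxBirkhoffSum [IsFiniteMeasure μ] (hT : MeasurePreserving T μ μ)
    (hg : Integrable g μ) (n : ℕ) : Integrable (maxBirkhoffSum T g n) μ := by
  induction n with
  | zero => simp [funext fun x => show maxBirkhoffSum T g 0 x = 0 by simp [maxBirkhoffSum]]
  | succ n ih =>
    rw [funext (maxBirkhoffSum_succ T g n)]
    exact (integrable_const (0 : ℝ)).sup (hg.add (hT.integrable_comp_of_integrable ih))

theorem integral_max_neg_maxBirkhoffSum_nonneg [IsFiniteMeasure μ] (hT : MeasurePreserving T μ μ)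
    (hg : Integrable g μ) (n : ℕ) : 0 ≤ ∫ x, max (-maxBirkhoffSum T g n (T x)) (g x) ∂μ := by
  have hinteg := integrable_maxBirkhoffSum hT hg
  have hcompint : Integrable (fun x => maxBirkhoffSum T g n (T x)) μ :=
    hT.integrable_comp_of_integrable (hinteg n)
  have hcomp : ∫ x, maxBirkhoffSum T g n (T x) ∂μ = ∫ x, maxBirkhoffSum T g n x ∂μ := by
    rw [← integral_map hT.aemeasurable (by rw [hT.map_eq]; exact (hinteg n).1), hT.map_eq]
  simp only [← maxBirkhoffSum_succ_sub_comp]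
  rw [integral_sub (hinteg _) hcompint, hcomp, sub_nonneg]
  exact integral_mono (hinteg n) (hinteg _) fun x => monotone_maxBirkhoffSum T g x n.le_succ

theorem integral_nonneg_of_ae_not_bddAbove_birkhoffSum [IsFiniteMeasure μ]
    (hT : MeasurePreserving T μ μ) (hg : Integrable g μ)
    (hunbdd : ∀ᵐ x ∂μ, ¬BddAbove (Set.range fun n => birkhoffSum T g n x)) :
    0 ≤ ∫ x, g x ∂μ := by
  have hlim : Tendsto (fun n => ∫ x, max (-maxBirkhoffSum T g n (T x)) (g x) ∂μ) atTop
      (𝓝 (∫ x, g x ∂μ)) := by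
    refine tendsto_integral_of_dominated_convergence (fun x => |g x|) (fun n => ?_) hg.abs
      (fun n => ae_of_all _ fun x => ?_) ?_
    · exact ((hT.integrable_comp_of_integrable
        (integrable_maxBirkhoffSum hT hg n)).neg.sup hg).aestronglyMeasurable
    · rw [Real.norm_eq_abs, abs_le]
      refine ⟨(neg_abs_le _).trans (le_max_right _ _), max_le ?_ (le_abs_self _)⟩
      linarith [abs_nonneg (g x), maxBirkhoffSum_nonneg T g n (T x)]
    · filter_upwards [hunbdd] with x hx
      obtain ⟨_, ⟨m, rfl⟩, hm⟩ :=
        not_bddAbove_iff.1 (mt (bddAbove_range_birkhoffSum_comp_iff T g x).1 hx) (-g x)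
      refine tendsto_const_nhds.congr' ?_
      filter_upwards [eventually_ge_atTop m] with n hn
      have hmn : birkhoffSum T g m (T x) ≤ maxBirkhoffSum T g n (T x) :=
        (birkhoffSum_le_maxBirkhoffSum T g m (T x)).trans (monotone_maxBirkhoffSum T g (T x) hn)
      rw [max_eq_right (by linarith)]
  exact ge_of_tendsto' hlim (integral_max_neg_maxBirkhoffSum_nonneg hT hg)

theorem ae_bddAbove_birkhoffSum_of_integral_neg [IsFiniteMeasure μ] (hT : Ergodic T μ)
    (hgm : Measurable g) (hg : Integrable g μ) (hneg : ∫ x, g x ∂μ < 0) :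
    ∀ᵐ x ∂μ, BddAbove (Set.range fun n => birkhoffSum T g n x) := by
  have hmeas : MeasurableSet {x | BddAbove (Set.range fun n => birkhoffSum T g n x)} :=
    measurableSet_bddAbove_range fun n => measurable_birkhoffSum hT.measurable hgm n
  have hinv : T ⁻¹' {x | BddAbove (Set.range fun n => birkhoffSum T g n x)} =
      {x | BddAbove (Set.range fun n => birkhoffSum T g n x)} :=
    Set.ext (bddAbove_range_birkhoffSum_comp_iff T g)
  refine (hT.ae_mem_or_ae_notMem hmeas hinv).resolve_right fun hunbdd => hneg.not_ge ?_
  exact integral_nonneg_of_ae_not_bddAbove_birkhoffSum hT.toMeasurePreserving hg hunbdd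

theorem ae_eventually_birkhoffAverage_lt [IsProbabilityMeasure μ] (hT : Ergodic T μ)
    (hgm : Measurable g) (hg : Integrable g μ) {c : ℝ} (hc : ∫ x, g x ∂μ < c) :
    ∀ᵐ x ∂μ, ∀ᶠ n in atTop, birkhoffAverage ℝ T g n x < c := by
  obtain ⟨d, hd, hdc⟩ := exists_between hc
  have hneg : ∫ x, (g x - d) ∂μ < 0 := by
    rw [integral_sub hg (integrable_const _)]
    simpa using hd
  filter_upwards [ae_bddAbove_birkhoffSum_of_integral_neg hT (hgm.sub_const d)
    (hg.sub (integrable_const d)) hneg] with x ⟨C, hC⟩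
  have hlim : Tendsto (fun n : ℕ => C / n + d) atTop (𝓝 d) := by
    simpa using (tendsto_const_div_atTop_nhds_zero_nat C).add_const d
  filter_upwards [hlim.eventually_lt_const hdc, eventually_gt_atTop 0] with n hn hn0
  refine lt_of_le_of_lt ?_ hn
  have hn0' : (0 : ℝ) < n := Nat.cast_pos.2 hn0
  have hsum : birkhoffSum T g n x - n * d ≤ C := by
    simpa [birkhoffSum, Finset.sum_sub_distrib] using hC ⟨n, rfl⟩
  rw [birkhoffAverage, smul_eq_mul, inv_mul_le_iff₀ hn0', mul_add, mul_div_cancel₀ _ hn0'.ne']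
  linarith

theorem ae_tendsto_birkhoffAverage_integral [IsProbabilityMeasure μ] (hT : Ergodic T μ)
    (hgm : Measurable g) (hg : Integrable g μ) :
    ∀ᵐ x ∂μ, Tendsto (fun n => birkhoffAverage ℝ T g n x) atTop (𝓝 (∫ x, g x ∂μ)) := by
  have hupper : ∀ᵐ x ∂μ, ∀ q : ℚ, ∫ x, g x ∂μ < q →
      ∀ᶠ n in atTop, birkhoffAverage ℝ T g n x < q :=
    ae_all_iff.2 fun _ => eventually_imp_distrib_left.2 fun hq =>
      ae_eventually_birkhoffAverage_lt hT hgm hg hq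
  have hlower : ∀ᵐ x ∂μ, ∀ q : ℚ, q < ∫ x, g x ∂μ →
      ∀ᶠ n in atTop, q < birkhoffAverage ℝ T g n x := by
    refine ae_all_iff.2 fun q => eventually_imp_distrib_left.2 fun hq => ?_
    have hneg : ∫ x, (-g) x ∂μ < -(q : ℝ) := by simpa [integral_neg] using hq
    filter_upwards [ae_eventually_birkhoffAverage_lt hT hgm.neg hg.neg hneg] with x hx
    simpa [birkhoffAverage_neg] using hx
  filter_upwards [hupper, hlower] with x hxu hxl
  refine tendsto_order.2 ⟨fun b hb => ?_, fun b hb => ?_⟩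
  · obtain ⟨q, hbq, hq⟩ := exists_rat_btwn hb
    exact (hxl q hq).mono fun n hn => hbq.trans hn
  · obtain ⟨q, hq, hqb⟩ := exists_rat_btwn hb
    exact (hxu q hq).mono fun n hn => hn.trans hqb

end PointwiseErgodicTheorem

section VisitFrequency

variable {α : Type*}

open Classical in
/-- The proportion of the first `n` terms of the sequence `x` that lie in `C`. -/
noncomputable def visitFreq (C : Set α) (x : ℕ → α) (n : ℕ) : ℝ :=
  ((Finset.range n).filter fun i => x i ∈ C).card / n

theorem visitFreq_nonneg (C : Set α) (x : ℕ → α) (n : ℕ) : 0 ≤ visitFreq C x n := by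
  unfold visitFreq
  positivity

theorem visitFreq_mono {C D : Set α} (h : C ⊆ D) (x : ℕ → α) (n : ℕ) :
    visitFreq C x n ≤ visitFreq D x n := by
  unfold visitFreq
  gcongr with i

theorem visitFreq_union_le (C D : Set α) (x : ℕ → α) (n : ℕ) :
    visitFreq (C ∪ D) x n ≤ visitFreq C x n + visitFreq D x n := by
  classical
  simp only [visitFreq, ← add_div]
  gcongr
  refine mod_cast (Finset.card_le_card fun i hi => ?_).trans (Finset.card_union_le _ _)
  simpa [← and_or_left] using hi

theorem visitFreq_add_visitFreq_compl (C : Set α) (x : ℕ → α) {n : ℕ} (hn : n ≠ 0) :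
    visitFreq C x n + visitFreq Cᶜ x n = 1 := by
  classical
  simp only [visitFreq, Set.mem_compl_iff, ← add_div]
  rw [← Nat.cast_add, Finset.card_filter_add_card_filter_not (x · ∈ C), Finset.card_range,
    div_self (Nat.cast_ne_zero.2 hn)]

theorem birkhoffAverage_indicator_one (T : α → α) (C : Set α) (n : ℕ) (x : α) :
    birkhoffAverage ℝ T (C.indicator 1) n x = visitFreq C (fun i => T^[i] x) n := by
  classical
  simp [birkhoffAverage, birkhoffSum, visitFreq, Set.indicator_apply, inv_mul_eq_div]

theorem tendsto_visitFreq_zero {C : Set α} {x : ℕ → α} (h : ∀ᶠ i in atTop, x i ∉ C) :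
    Tendsto (visitFreq C x) atTop (𝓝 0) := by
  classical
  obtain ⟨m, hm⟩ := eventually_atTop.1 h
  refine squeeze_zero (visitFreq_nonneg C x) (fun n => ?_)
    (tendsto_const_div_atTop_nhds_zero_nat (m : ℝ))
  unfold visitFreq
  gcongr
  refine (Finset.card_le_card fun i hi => ?_).trans_eq (Finset.card_range m)
  exact Finset.mem_range.2 (not_le.1 fun hmi => hm i hmi (Finset.mem_filter.1 hi).2)

theorem frequently_mem_of_tendsto_visitFreq {C : Set α} {x : ℕ → α} {p : ℝ}
    (h : Tendsto (visitFreq C x) atTop (𝓝 p)) (hp : 0 < p) : ∃ᶠ i in atTop, x i ∈ C :=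
  fun hnot => hp.ne' (tendsto_nhds_unique h (tendsto_visitFreq_zero hnot))

end VisitFrequency

section OrderStatistics

theorem orderStat_mem_range (x : ℕ → ℝ) {k n : ℕ} (h : 1 ≤ k ∧ k ≤ n) :
    orderStat x k n ∈ Set.range x := by
  rw [orderStat, dif_pos h]
  exact Set.mem_range_self _

theorem orderStat_le_iff (x : ℕ → ℝ) {k n : ℕ} (h : 1 ≤ k ∧ k ≤ n) (y : ℝ) :
    orderStat x k n ≤ y ↔ k ≤ ((Finset.range n).filter fun i => x i ≤ y).card := by
  set σ := Tuple.sort fun i : Fin n => x i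
  have hcard : ((Finset.range n).filter fun i => x i ≤ y).card =
      (Finset.univ.filter fun i : Fin n => x (σ i) ≤ y).card := by
    simp only [Finset.card_filter]
    rw [Equiv.sum_comp σ fun i : Fin n => if x i ≤ y then 1 else 0]
    exact (Fin.sum_univ_eq_sum_range (fun i => if x i ≤ y then 1 else 0) n).symm
  have hsort : k - 1 < (Finset.univ.filter fun i : Fin n => x (σ i) ≤ y).card ↔
      x (σ ⟨k - 1, by omega⟩) ≤ y :=
    Tuple.lt_card_le_iff_apply_le_of_monotone (j := ⟨k - 1, by omega⟩)
      (Tuple.monotone_sort fun i : Fin n => x i)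
  rw [orderStat, dif_pos h, hcard, ← hsort]
  omega

theorem orderStat_const_mul {v : ℝ} (hv : 0 < v) (x : ℕ → ℝ) (k n : ℕ) :
    orderStat (fun i => v * x i) k n = v * orderStat x k n := by
  by_cases h : 1 ≤ k ∧ k ≤ n
  · refine eq_of_forall_ge_iff fun y => ?_
    simp only [orderStat_le_iff _ h, ← le_div_iff₀' hv]
  · simp only [orderStat, dif_neg h, mul_zero]

theorem nearCount_const_mul {v : ℝ} (hv : 0 < v) (x : ℕ → ℝ) (k n : ℕ) (a : ℝ) :
    nearCount (fun i => v * x i) k n a = nearCount x k n (a / v) := by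
  have hleft : ∀ i, v * orderStat x k n - a < v * x i ↔ orderStat x k n - a / v < x i := fun i => by
    rw [← mul_lt_mul_iff_right₀ hv (b := orderStat x k n - a / v), mul_sub,
      mul_div_cancel₀ _ hv.ne']
  simp only [nearCount, orderStat_const_mul hv, hleft, mul_lt_mul_iff_right₀ hv]

theorem nearCount_div_eq_visitFreq (x : ℕ → ℝ) (k n : ℕ) (a : ℝ) :
    (nearCount x k n a : ℝ) / n =
      visitFreq (Set.Ioo (orderStat x k n - a) (orderStat x k n)) x n := by
  simp only [nearCount, visitFreq, Set.mem_Ioo]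

theorem visitFreq_Ioi_le_of_orderStat_le (x : ℕ → ℝ) {k n : ℕ} (h : 1 ≤ k ∧ k ≤ n) {y : ℝ}
    (hy : orderStat x k n ≤ y) : visitFreq (Set.Ioi y) x n ≤ 1 - (k : ℝ) / n := by
  have hbelow : (k : ℝ) / n ≤ visitFreq (Set.Iic y) x n := by
    simp only [visitFreq, Set.mem_Iic]
    gcongr
    convert (orderStat_le_iff x h y).1 hy
  have hsum := visitFreq_add_visitFreq_compl (Set.Iic y) x (n := n) (by omega)
  rw [Set.compl_Iic] at hsum
  linarith

theorem measurable_orderStat (k n : ℕ) : Measurable fun x : ℕ → ℝ => orderStat x k n := by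
  by_cases h : 1 ≤ k ∧ k ≤ n
  · refine measurable_of_Iic fun y => ?_
    simp only [Set.preimage, Set.mem_Iic, orderStat_le_iff _ h, Finset.card_filter]
    refine measurableSet_le measurable_const (Finset.measurable_fun_sum _ fun i _ => ?_)
    exact Measurable.ite (measurableSet_le (measurable_pi_apply i) measurable_const)
      measurable_const measurable_const
  · simp only [orderStat, dif_neg h, measurable_const]

theorem measurable_nearCount (k n : ℕ) (a : ℝ) : Measurable fun x : ℕ → ℝ => nearCount x k n a := by
  have hord := measurable_orderStat k n
  simp only [nearCount, Finset.card_filter]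
  refine Finset.measurable_fun_sum _ fun i _ => Measurable.ite (MeasurableSet.inter ?_ ?_)
    measurable_const measurable_const
  · exact measurableSet_lt (hord.sub_const a) (measurable_pi_apply i)
  · exact measurableSet_lt (measurable_pi_apply i) hord

end OrderStatistics

section EmpiricalTails

theorem tendsto_apply_of_antitone {ι : Type*} {l : Filter ι} {F : ι → ℝ → ℝ} {G : ℝ → ℝ} {D : Set ℝ}
    {u : ι → ℝ} {y : ℝ} (hF : ∀ i, Antitone (F i)) (hD : Dense D)
    (hFG : ∀ q ∈ D, Tendsto (F · q) l (𝓝 (G q))) (hG : ContinuousAt G y) (hu : Tendsto u l (𝓝 y)) :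
    Tendsto (fun i => F i (u i)) l (𝓝 (G y)) := by
  refine tendsto_order.2 ⟨fun b hb => ?_, fun b hb => ?_⟩
  · obtain ⟨z, hyz, hz⟩ := exists_Ico_subset_of_mem_nhds (hG.eventually_const_lt hb) (exists_gt y)
    obtain ⟨q, hqD, hyq, hqz⟩ := hD.exists_between hyz
    filter_upwards [hu.eventually_lt_const hyq,
      (hFG q hqD).eventually_const_lt (hz ⟨hyq.le, hqz⟩)] with i hui hFi
    exact hFi.trans_le (hF i hui.le)
  · obtain ⟨z, hzy, hz⟩ := exists_Ioc_subset_of_mem_nhds (hG.eventually_lt_const hb) (exists_lt y)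
    obtain ⟨q, hqD, hzq, hqy⟩ := hD.exists_between hzy
    filter_upwards [hu.eventually_const_lt hqy,
      (hFG q hqD).eventually_lt_const (hz ⟨hzq, hqy.le⟩)] with i hui hFi
    exact (hF i hui.le).trans_lt hFi

/-- The empirical tails of the sequence `x` converge to those of the measure `ν`.
Only rational thresholds are required, so that the property holds almost surely for an ergodic
sequence as soon as it does so for each threshold. -/
def HasTailFrequencies (ν : Measure ℝ) (x : ℕ → ℝ) : Prop :=
  ∀ q : ℚ, Tendsto (visitFreq (Set.Ioi (q : ℝ)) x) atTop (𝓝 (ν.real (Set.Ioi (q : ℝ))))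

variable {ν : Measure ℝ} {x : ℕ → ℝ}

theorem antitone_visitFreq_Ioi (x : ℕ → ℝ) (n : ℕ) :
    Antitone fun y => visitFreq (Set.Ioi y) x n :=
  fun _ _ h => visitFreq_mono (Set.Ioi_subset_Ioi h) x n

theorem HasTailFrequencies.frequently_lt (hx : HasTailFrequencies ν x) {r γ : ℝ}
    (hr : r < γ) (hγ : ∀ r < γ, 0 < ν.real (Set.Ioi r)) : ∃ᶠ i in atTop, r < x i := by
  obtain ⟨q, hrq, hqγ⟩ := exists_rat_btwn hr
  exact (frequently_mem_of_tendsto_visitFreq (hx q) (hγ q hqγ)).mono fun i hi => hrq.trans hi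

theorem HasTailFrequencies.tendsto_orderStat (hx : HasTailFrequencies ν x) {k : ℕ → ℕ}
    (hk : ∀ n, 1 ≤ n → 1 ≤ k n ∧ k n ≤ n)
    (hklim : Tendsto (fun n => (k n : ℝ) / n) atTop (𝓝 1)) {γ : ℝ} (hxγ : ∀ i, x i ≤ γ)
    (hγ : ∀ r < γ, 0 < ν.real (Set.Ioi r)) :
    Tendsto (fun n => orderStat x (k n) n) atTop (𝓝 γ) := by
  refine tendsto_order.2 ⟨fun r hr => ?_, fun r hr => ?_⟩
  · obtain ⟨q, hrq, hqγ⟩ := exists_rat_btwn hr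
    have hlim : Tendsto (fun n => visitFreq (Set.Ioi (q : ℝ)) x n + (k n : ℝ) / n) atTop
        (𝓝 (ν.real (Set.Ioi (q : ℝ)) + 1)) := (hx q).add hklim
    filter_upwards [hlim.eventually_const_lt (lt_add_of_pos_left 1 (hγ q hqγ)),
      eventually_ge_atTop 1] with n hn hn1
    by_contra! hle
    linarith [visitFreq_Ioi_le_of_orderStat_le x (hk n hn1) (hle.trans hrq.le)]
  · filter_upwards [eventually_ge_atTop 1] with n hn1
    obtain ⟨i, hi⟩ := orderStat_mem_range x (hk n hn1)
    exact hi ▸ (hxγ i).trans_lt hr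

variable [IsProbabilityMeasure ν]

theorem measureReal_Ioi_eq_one_sub_cdf (y : ℝ) : ν.real (Set.Ioi y) = 1 - cdf ν y := by
  rw [cdf_eq_real, ← Set.compl_Iic, probReal_compl_eq_one_sub measurableSet_Iic]

theorem continuousAt_measureReal_Ioi {y : ℝ} (hy : ν {y} = 0) :
    ContinuousAt (fun z => ν.real (Set.Ioi z)) y := by
  have hleft : Function.leftLim (cdf ν) y = cdf ν y := by
    have hjump := (cdf ν).measure_singleton y
    rw [measure_cdf, hy, eq_comm, ENNReal.ofReal_eq_zero, sub_nonpos] at hjump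
    exact ((monotone_cdf ν).leftLim_le le_rfl).antisymm hjump
  have hcdf : ContinuousAt (cdf ν) y := continuousAt_iff_continuous_left'_right'.2
    ⟨(monotone_cdf ν).continuousWithinAt_Iio_iff_leftLim_eq.2 hleft,
      ((cdf ν).right_continuous y).mono Set.Ioi_subset_Ici_self⟩
  simp only [measureReal_Ioi_eq_one_sub_cdf]
  exact continuousAt_const.sub hcdf

theorem HasTailFrequencies.tendsto_visitFreq_Ioi (hx : HasTailFrequencies ν x) {y : ℝ}
    (hy : ν {y} = 0) {u : ℕ → ℝ} (hu : Tendsto u atTop (𝓝 y)) :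
    Tendsto (fun n => visitFreq (Set.Ioi (u n)) x n) atTop (𝓝 (ν.real (Set.Ioi y))) :=
  tendsto_apply_of_antitone (antitone_visitFreq_Ioi x) Rat.denseRange_cast
    (by rintro _ ⟨q, rfl⟩; exact hx q) (continuousAt_measureReal_Ioi hy) hu

theorem HasTailFrequencies.tendsto_nearCount_div (hx : HasTailFrequencies ν x) {k : ℕ → ℕ}
    {γ b : ℝ} (hord : Tendsto (fun n => orderStat x (k n) n) atTop (𝓝 γ))
    (hγ : ν (Set.Ici γ) = 0) (hb : ν {γ - b} = 0) :
    Tendsto (fun n => (nearCount x (k n) n b : ℝ) / n) atTop (𝓝 (ν.real (Set.Ioi (γ - b)))) := by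
  set τ : ℕ → ℝ := fun n => orderStat x (k n) n
  have htail : Tendsto (fun n => visitFreq (Set.Ioi (τ n - b)) x n) atTop
      (𝓝 (ν.real (Set.Ioi (γ - b)))) := hx.tendsto_visitFreq_Ioi hb (hord.sub_const b)
  have htop : Tendsto (fun n : ℕ => visitFreq (Set.Ioi (τ n - 1 / ((n : ℝ) + 1))) x n) atTop
      (𝓝 0) := by
    have hu : Tendsto (fun n : ℕ => τ n - 1 / ((n : ℝ) + 1)) atTop (𝓝 γ) := by
      simpa using hord.sub tendsto_one_div_add_atTop_nhds_zero_nat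
    have hzero : ν.real (Set.Ioi γ) = 0 := by
      rw [measureReal_eq_zero_iff, measure_mono_null Set.Ioi_subset_Ici_self hγ]
    exact hzero ▸ hx.tendsto_visitFreq_Ioi
      (measure_mono_null (Set.singleton_subset_iff.2 Set.self_mem_Ici) hγ) hu
  refine tendsto_of_tendsto_of_tendsto_of_le_of_le
    (by simpa only [sub_zero] using htail.sub htop) htail (fun n => ?_) (fun n => ?_)
  · -- The closed tail `[τ n, ∞)` is enlarged to an open one, to which `hx` applies.
    have hcover : Set.Ioi (τ n - b) ⊆
        Set.Ioo (τ n - b) (τ n) ∪ Set.Ioi (τ n - 1 / ((n : ℝ) + 1)) := fun y hy =>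
      (lt_or_ge y (τ n)).imp (fun hlt => ⟨hy, hlt⟩)
        fun hle => (sub_lt_self _ Nat.one_div_pos_of_nat).trans_le hle
    have := (visitFreq_mono hcover x n).trans (visitFreq_union_le _ _ x n)
    rw [nearCount_div_eq_visitFreq]
    linarith
  · rw [nearCount_div_eq_visitFreq]
    exact visitFreq_mono Set.Ioo_subset_Ioi_self x n

end EmpiricalTails

section Stationarity

theorem seqShift_iterate (x : ℕ → ℝ) (i : ℕ) : seqShift^[i] x = fun n => x (i + n) := by
  induction i generalizing x with
  | zero => simp only [Function.iterate_zero, id, zero_add]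
  | succ i ih =>
    funext n
    rw [Function.iterate_succ_apply, ih]
    simp only [seqShift, Nat.add_right_comm]

theorem measurable_seqShift : Measurable seqShift :=
  measurable_pi_lambda _ fun n => measurable_pi_apply (n + 1)

variable {Ω : Type*} {S : ℕ → Ω → ℝ}

theorem measurable_invariantSigma_of_comp_seqShift_eq {Φ : (ℕ → ℝ) → ℝ} (hΦ : Measurable Φ)
    (hinv : ∀ s, Φ (seqShift s) = Φ s) :
    Measurable[invariantSigma S] fun ω => Φ fun n => S n ω := by
  refine fun C hC => ⟨Φ ⁻¹' C, hΦ hC, fun i => Set.ext fun ω => ?_⟩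
  have hiter : Φ (seqShift^[i] fun n => S n ω) = Φ fun n => S n ω :=
    congrFun (Function.iterate_invariant (funext hinv) i) _
  rw [seqShift_iterate] at hiter
  rw [Set.mem_preimage, ← hiter]
  rfl

variable [MeasurableSpace Ω] {P : Measure Ω}

theorem IsStrictlyStationary.map_shift (hS : ∀ n, Measurable (S n))
    (hstat : IsStrictlyStationary P S) (i : ℕ) :
    P.map (fun ω n => S (i + n) ω) = seqLaw P S := by
  have hiter : (fun ω n => S (i + n) ω) = seqShift^[i] ∘ fun ω n => S n ω :=
    funext fun ω => (seqShift_iterate (fun n => S n ω) i).symm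
  rw [hiter, ← Measure.map_map (measurable_seqShift.iterate i) (measurable_pi_lambda _ hS)]
  exact (hstat.iterate i).map_eq

theorem IsStrictlyStationary.ae_shift (hS : ∀ n, Measurable (S n))
    (hstat : IsStrictlyStationary P S) {p : (ℕ → ℝ) → Prop} (hp : MeasurableSet {s | p s})
    (h : ∀ᵐ ω ∂P, p fun n => S n ω) (i : ℕ) : ∀ᵐ ω ∂P, p fun n => S (i + n) ω := by
  refine ae_of_ae_map (measurable_pi_lambda _ fun n => hS (i + n)).aemeasurable ?_
  rw [hstat.map_shift hS i]
  exact (ae_map_iff (measurable_pi_lambda _ hS).aemeasurable hp).2 h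

theorem invariantSigma_le (hS : ∀ n, Measurable (S n)) :
    invariantSigma S ≤ ‹MeasurableSpace Ω› := by
  rintro A ⟨B, hB, hAB⟩
  rw [hAB 0]
  exact (measurable_pi_lambda _ fun n => hS (0 + n)) hB

theorem aestronglyMeasurable_invariantSigma_of_tendsto_birkhoffAverage {f : (ℕ → ℝ) → ℝ}
    (hf : Measurable f) {C : ℝ} (hfC : ∀ s, |f s| ≤ C) {L : Ω → ℝ}
    (hlim : ∀ᵐ ω ∂P, Tendsto (fun n => birkhoffAverage ℝ seqShift f n fun i => S i ω) atTop
      (𝓝 (L ω))) :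
    AEStronglyMeasurable[invariantSigma S] L P := by
  set Φ : (ℕ → ℝ) → ℝ := fun s => limUnder atTop fun n => birkhoffAverage ℝ seqShift f n s
  have hΦ : Measurable Φ := (StronglyMeasurable.limUnder fun n =>
    ((measurable_birkhoffSum measurable_seqShift hf n).const_smul
      (n : ℝ)⁻¹).stronglyMeasurable).measurable
  have hbdd : Bornology.IsBounded (Set.range f) :=
    isBounded_iff_forall_norm_le.2 ⟨C, Set.forall_mem_range.2 hfC⟩
  have hiff : ∀ s ℓ, Tendsto (fun n => birkhoffAverage ℝ seqShift f n (seqShift s)) atTop (𝓝 ℓ) ↔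
      Tendsto (fun n => birkhoffAverage ℝ seqShift f n s) atTop (𝓝 ℓ) := fun s ℓ =>
    tendsto_iff_of_dist (by
      simpa [dist_eq_norm] using
        (tendsto_birkhoffAverage_apply_sub_birkhoffAverage' ℝ hbdd seqShift s).norm)
  -- `limUnder` chooses among the limits, so it is invariant also where the averages diverge.
  have hinv : ∀ s, Φ (seqShift s) = Φ s := fun s =>
    congrArg Classical.epsilon (funext fun ℓ => propext (hiff s ℓ))
  refine ⟨_, (measurable_invariantSigma_of_comp_seqShift_eq hΦ hinv).stronglyMeasurable, ?_⟩
  filter_upwards [hlim] with ω hω using hω.limUnder_eq.symm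

variable [IsFiniteMeasure P]

theorem IsStrictlyStationary.condExp_shift (hS : ∀ n, Measurable (S n))
    (hstat : IsStrictlyStationary P S) {f : (ℕ → ℝ) → ℝ} (hf : Integrable f (seqLaw P S)) (i : ℕ) :
    P[fun ω => f fun n => S (i + n) ω | invariantSigma S] =ᵐ[P]
      P[fun ω => f fun n => S n ω | invariantSigma S] := by
  have hmeas : ∀ j, Measurable fun ω n => S (j + n) ω := fun j =>
    measurable_pi_lambda _ fun n => hS (j + n)
  have hinteg : ∀ j, Integrable (fun ω => f fun n => S (j + n) ω) P := fun j => by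
    rw [← hstat.map_shift hS j] at hf
    exact hf.comp_measurable (hmeas j)
  have hfint0 : Integrable (fun ω => f fun n => S n ω) P := by simpa only [zero_add] using hinteg 0
  refine (ae_eq_condExp_of_forall_setIntegral_eq (invariantSigma_le hS) (hinteg i)
    (fun _ _ _ => integrable_condExp.integrableOn) (fun A hA _ => ?_)
    stronglyMeasurable_condExp.aestronglyMeasurable).symm
  obtain ⟨B, hB, hAB⟩ := hA
  have hlaw : ∀ j, ∫ ω in A, f (fun n => S (j + n) ω) ∂P = ∫ s in B, f s ∂seqLaw P S := fun j => by
    rw [← hstat.map_shift hS j] at hf ⊢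
    rw [setIntegral_map hB hf.aestronglyMeasurable (hmeas j).aemeasurable, hAB j]
    rfl
  rw [setIntegral_condExp (invariantSigma_le hS) hfint0 ⟨B, hB, hAB⟩, hlaw i, ← hlaw 0]
  simp only [zero_add]

theorem IsStrictlyStationary.condExp_birkhoffAverage (hS : ∀ n, Measurable (S n))
    (hstat : IsStrictlyStationary P S) {f : (ℕ → ℝ) → ℝ} (hf : Integrable f (seqLaw P S)) {n : ℕ}
    (hn : n ≠ 0) :
    P[fun ω => birkhoffAverage ℝ seqShift f n fun i => S i ω | invariantSigma S] =ᵐ[P]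
      P[fun ω => f fun i => S i ω | invariantSigma S] := by
  have hsum : (fun ω => birkhoffAverage ℝ seqShift f n fun i => S i ω) =
      (n : ℝ)⁻¹ • ∑ i ∈ Finset.range n, fun ω => f fun m => S (i + m) ω := by
    funext ω
    simp only [birkhoffAverage, birkhoffSum, seqShift_iterate, Pi.smul_apply, Finset.sum_apply]
  have hinteg : ∀ i, Integrable (fun ω => f fun m => S (i + m) ω) P := fun i => by
    rw [← hstat.map_shift hS i] at hf
    exact hf.comp_measurable (measurable_pi_lambda _ fun m => hS (i + m))
  rw [hsum]
  filter_upwards [condExp_smul (m := invariantSigma S) (μ := P) (n : ℝ)⁻¹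
      (∑ i ∈ Finset.range n, fun ω => f fun m => S (i + m) ω),
    condExp_finsetSum (m := invariantSigma S) (s := Finset.range n) fun i _ => hinteg i,
    ae_all_iff.2 (hstat.condExp_shift hS hf)] with ω hsmul hadd hshift
  rw [hsmul, Pi.smul_apply, hadd, Finset.sum_apply, Finset.sum_congr rfl fun i _ => hshift i,
    Finset.sum_const, Finset.card_range, nsmul_eq_mul, smul_eq_mul,
    inv_mul_cancel_left₀ (Nat.cast_ne_zero.2 hn)]

theorem abs_birkhoffAverage_le {α : Type*} {T : α → α} {f : α → ℝ} {C : ℝ} (hC : ∀ x, |f x| ≤ C)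
    {n : ℕ} (hn : n ≠ 0) (x : α) : |birkhoffAverage ℝ T f n x| ≤ C := by
  rw [birkhoffAverage, birkhoffSum, smul_eq_mul, abs_mul, abs_inv, Nat.abs_cast,
    inv_mul_le_iff₀ (Nat.cast_pos.2 hn.bot_lt)]
  calc |∑ i ∈ Finset.range n, f (T^[i] x)| ≤ ∑ i ∈ Finset.range n, |f (T^[i] x)| :=
        Finset.abs_sum_le_sum_abs _ _
    _ ≤ n * C := by simpa using Finset.sum_le_sum fun i (_ : i ∈ Finset.range n) => hC (T^[i] x)

theorem IsStrictlyStationary.condExp_ae_eq_of_tendsto_birkhoffAverage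
    (hS : ∀ n, Measurable (S n)) (hstat : IsStrictlyStationary P S) {f : (ℕ → ℝ) → ℝ}
    (hf : Measurable f) {C : ℝ} (hfC : ∀ s, |f s| ≤ C) {L : Ω → ℝ}
    (hlim : ∀ᵐ ω ∂P, Tendsto (fun n => birkhoffAverage ℝ seqShift f n fun i => S i ω) atTop
      (𝓝 (L ω))) :
    P[fun ω => f fun i => S i ω | invariantSigma S] =ᵐ[P] L := by
  have hSm : Measurable fun ω n => S n ω := measurable_pi_lambda _ hS
  have hinteg : ∀ {g : (ℕ → ℝ) → ℝ}, Measurable g → (∀ s, |g s| ≤ C) →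
      Integrable (fun ω => g fun i => S i ω) P := fun hg hgC =>
    .of_bound (hg.comp hSm).aestronglyMeasurable C (ae_of_all _ fun ω => hgC _)
  have hAm : ∀ n, Measurable (birkhoffAverage ℝ seqShift f n) := fun n =>
    (measurable_birkhoffSum measurable_seqShift hf n).const_smul (n : ℝ)⁻¹
  have hAC : ∀ n s, |birkhoffAverage ℝ seqShift f (n + 1) s| ≤ C := fun n =>
    abs_birkhoffAverage_le hfC n.succ_ne_zero
  have hlim' : ∀ᵐ ω ∂P, Tendsto (fun n => birkhoffAverage ℝ seqShift f (n + 1) fun i => S i ω)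
      atTop (𝓝 (L ω)) := hlim.mono fun ω hω => hω.comp (tendsto_add_atTop_nat 1)
  have hLmeas := aestronglyMeasurable_invariantSigma_of_tendsto_birkhoffAverage hf hfC hlim
  have hLint : Integrable L P :=
    .of_bound (hLmeas.mono (invariantSigma_le hS)) C
      (hlim'.mono fun ω hω => le_of_tendsto' hω.norm fun n => hAC n _)
  have : IsFiniteMeasure (seqLaw P S) := Measure.isFiniteMeasure_map _ _
  have hfint : Integrable f (seqLaw P S) :=
    .of_bound hf.aestronglyMeasurable C (ae_of_all _ hfC)
  have hconst : P[L | invariantSigma S] =ᵐ[P] P[fun ω => f fun i => S i ω | invariantSigma S] :=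
    tendsto_condExp_unique (fun n ω => birkhoffAverage ℝ seqShift f (n + 1) fun i => S i ω)
      (fun _ ω => f fun i => S i ω) _ _ (fun n => hinteg (hAm _) (hAC n)) (fun _ => hinteg hf hfC)
      hlim' (ae_of_all _ fun _ => tendsto_const_nhds) (fun _ => C) (integrable_const C)
      (fun _ => C) (integrable_const C) (fun n => ae_of_all _ fun ω => hAC n _)
      (fun _ => ae_of_all _ fun ω => hfC _)
      (fun n => hstat.condExp_birkhoffAverage hS hfint n.succ_ne_zero)
  exact hconst.symm.trans (condExp_of_aestronglyMeasurable' (invariantSigma_le hS) hLmeas hLint)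

end Stationarity

section RightEndpoint

variable {Ω : Type*} [MeasurableSpace Ω] {P : Measure Ω} [IsProbabilityMeasure P] {Y : Ω → ℝ}

theorem coe_lt_rightEndpoint_iff (hY : Measurable Y) {r : ℝ} :
    (r : EReal) < rightEndpoint P Y ↔ 0 < (P.map Y).real (Set.Ioi r) := by
  have : IsProbabilityMeasure (P.map Y) := Measure.isProbabilityMeasure_map hY.aemeasurable
  rw [measureReal_Ioi_eq_one_sub_cdf, sub_pos, rightEndpoint, lt_sSup_iff, Set.exists_mem_image]
  simp only [EReal.coe_lt_coe_iff, Set.mem_ofPred_eq]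
  constructor
  · rintro ⟨x, hx, hrx⟩
    exact (monotone_cdf (P.map Y) hrx.le).trans_lt hx
  · intro hr
    have hright := ((cdf (P.map Y)).right_continuous r).mono Set.Ioi_subset_Ici_self
    exact ((hright.eventually_lt_const hr).and self_mem_nhdsWithin).exists

theorem exists_coe_eq_rightEndpoint (hY : Measurable Y) (h : rightEndpoint P Y < ⊤) :
    ∃ γ : ℝ, rightEndpoint P Y = γ := by
  have : IsProbabilityMeasure (P.map Y) := Measure.isProbabilityMeasure_map hY.aemeasurable
  obtain ⟨x, hx⟩ := ((tendsto_cdf_atBot (P.map Y)).eventually_lt_const one_pos).exists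
  have hbot : ⊥ < rightEndpoint P Y := (EReal.bot_lt_coe x).trans_le (le_sSup ⟨x, hx, rfl⟩)
  exact ⟨_, (EReal.coe_toReal h.ne hbot.ne').symm⟩

theorem measureReal_Ioi_pos_of_lt_rightEndpoint (hY : Measurable Y) {γ : ℝ}
    (hγ : rightEndpoint P Y = γ) : ∀ r < γ, 0 < (P.map Y).real (Set.Ioi r) := fun _ hr =>
  (coe_lt_rightEndpoint_iff hY).1 (hγ ▸ EReal.coe_lt_coe_iff.2 hr)

theorem ae_le_rightEndpoint (hY : Measurable Y) {γ : ℝ} (hγ : rightEndpoint P Y = γ) :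
    ∀ᵐ ω ∂P, Y ω ≤ γ := by
  have : IsProbabilityMeasure (P.map Y) := Measure.isProbabilityMeasure_map hY.aemeasurable
  have hnull : P.map Y (Set.Ioi γ) = 0 := by
    rw [← measureReal_eq_zero_iff, ← measureReal_nonneg.not_lt_iff_eq',
      ← coe_lt_rightEndpoint_iff hY, hγ]
    exact lt_irrefl _
  rw [Measure.map_apply hY measurableSet_Ioi] at hnull
  filter_upwards [measure_eq_zero_iff_ae_notMem.1 hnull] with ω hω using not_lt.1 hω

theorem map_Ici_rightEndpoint_eq_zero (hY : Measurable Y) {γ : ℝ} (hγ : rightEndpoint P Y = γ)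
    (hatom : ∀ᵐ ω ∂P, Y ω ≠ γ) : P.map Y (Set.Ici γ) = 0 := by
  rw [Measure.map_apply hY measurableSet_Ici, measure_eq_zero_iff_ae_notMem]
  filter_upwards [ae_le_rightEndpoint hY hγ, hatom] with ω hle hne
  exact (hle.lt_of_ne hne).not_ge

end RightEndpoint

section ErgodicSequence

variable {Ω : Type*} [MeasurableSpace Ω] {P : Measure Ω} [IsProbabilityMeasure P] {X : ℕ → Ω → ℝ}

theorem IsStationaryErgodic.ae_tendsto_visitFreq (hX : ∀ n, Measurable (X n))
    (hXerg : IsStationaryErgodic P X) {C : Set ℝ} (hC : MeasurableSet C) :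
    ∀ᵐ ω ∂P, Tendsto (visitFreq C fun i => X i ω) atTop (𝓝 ((P.map (X 0)).real C)) := by
  have hXm : Measurable fun ω n => X n ω := measurable_pi_lambda _ hX
  have : IsProbabilityMeasure (seqLaw P X) := Measure.isProbabilityMeasure_map hXm.aemeasurable
  set B : Set (ℕ → ℝ) := {s | s 0 ∈ C}
  have hB : MeasurableSet B := measurable_pi_apply 0 hC
  have hlaw : ∫ s, B.indicator 1 s ∂seqLaw P X = (P.map (X 0)).real C := by
    rw [integral_indicator_one hB, seqLaw, map_measureReal_apply hXm hB,
      map_measureReal_apply (hX 0) hC]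
    rfl
  have herg := ae_tendsto_birkhoffAverage_integral hXerg
    (measurable_one.indicator hB) ((integrable_const (1 : ℝ)).indicator hB)
  rw [hlaw] at herg
  filter_upwards [ae_of_ae_map hXm.aemeasurable herg] with ω hω
  refine hω.congr fun n => ?_
  simp only [birkhoffAverage_indicator_one, seqShift_iterate]
  rfl

theorem IsStationaryErgodic.ae_hasTailFrequencies (hX : ∀ n, Measurable (X n))
    (hXerg : IsStationaryErgodic P X) :
    ∀ᵐ ω ∂P, HasTailFrequencies (P.map (X 0)) fun i => X i ω :=
  ae_all_iff.2 fun _ => hXerg.ae_tendsto_visitFreq hX measurableSet_Ioi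

theorem IsStationaryErgodic.ae_forall_atom_mem_range (hX : ∀ n, Measurable (X n))
    (hXerg : IsStationaryErgodic P X) :
    ∀ᵐ ω ∂P, ∀ y, P.map (X 0) {y} ≠ 0 → ∃ i, X i ω = y := by
  have hcount : {y : ℝ | 0 < P.map (X 0) {y}}.Countable := by
    simpa using! Measure.countable_meas_level_set_pos (μ := P.map (X 0)) measurable_id
  have hvisit : ∀ᵐ ω ∂P, ∀ y ∈ {y : ℝ | 0 < P.map (X 0) {y}}, ∃ i, X i ω = y :=
    (ae_ball_iff hcount).2 fun y hy => by
      have hpos : 0 < (P.map (X 0)).real {y} :=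
        ENNReal.toReal_pos hy.ne' (measure_ne_top _ _)
      filter_upwards [hXerg.ae_tendsto_visitFreq hX (measurableSet_singleton y)] with ω hω
      exact (frequently_mem_of_tendsto_visitFreq hω hpos).exists
  exact hvisit.mono fun ω hω y hy => hω y (pos_iff_ne_zero.2 hy)

theorem IsStationaryErgodic.ae_forall_le_rightEndpoint (hX : ∀ n, Measurable (X n))
    (hXerg : IsStationaryErgodic P X) {γ : ℝ} (hγ : rightEndpoint P (X 0) = γ) :
    ∀ᵐ ω ∂P, ∀ i, X i ω ≤ γ :=
  ae_all_iff.2 <| IsStrictlyStationary.ae_shift hX hXerg.toMeasurePreserving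
    (p := fun s => s 0 ≤ γ) (measurableSet_le (measurable_pi_apply 0) measurable_const)
    (ae_le_rightEndpoint (hX 0) hγ)

end ErgodicSequence

section ScaledSequence

/-- The sequences whose first term lies within `a` of the supremum. Up to null events,
`{X₁ + a / V > γ}` is the event that `(V X₁, V X₂, …)` lies in this set, which exhibits it as a
function of the scaled sequence alone. -/
def nearSup (a : ℝ) : Set (ℕ → ℝ) := {s | (⨆ n, s n) < s 0 + a}

theorem measurable_iSup_apply : Measurable fun s : ℕ → ℝ => ⨆ n, s n :=
  .iSup measurable_pi_apply

theorem measurableSet_nearSup (a : ℝ) : MeasurableSet (nearSup a) :=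
  measurableSet_lt measurable_iSup_apply (by fun_prop)

theorem isLUB_range_tail {x : ℕ → ℝ} {γ : ℝ} (hx : ∀ i, x i ≤ γ)
    (hfreq : ∀ r < γ, ∃ᶠ i in atTop, r < x i) (i : ℕ) : IsLUB (Set.range fun n => x (i + n)) γ := by
  refine ⟨Set.forall_mem_range.2 fun n => hx _, fun y hy => le_of_forall_lt fun r hr => ?_⟩
  obtain ⟨j, hij, hrj⟩ := frequently_atTop.1 (hfreq r hr) i
  exact hrj.trans_le (hy ⟨j - i, congrArg x (Nat.add_sub_of_le hij)⟩)

theorem mem_nearSup_const_mul_iff {v : ℝ} (hv : 0 < v) {x : ℕ → ℝ} {γ a : ℝ} {i : ℕ}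
    (hsup : ⨆ n, v * x (i + n) = v * γ) :
    (fun n => v * x (i + n)) ∈ nearSup a ↔ γ - a / v < x i := by
  simp only [nearSup, Set.mem_ofPred_eq, hsup, add_zero]
  rw [← sub_lt_iff_lt_add,
    ← mul_lt_mul_iff_right₀ hv (b := γ - a / v), mul_sub, mul_div_cancel₀ _ hv.ne']

variable {Ω : Type*} [MeasurableSpace Ω] {P : Measure Ω} [IsProbabilityMeasure P] {X : ℕ → Ω → ℝ}
  {V : Ω → ℝ} {a γ : ℝ}

theorem ae_iSup_scaled_tail (hX : ∀ n, Measurable (X n)) (hVpos : ∀ᵐ ω ∂P, 0 < V ω)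
    (hXerg : IsStationaryErgodic P X) (hγ : rightEndpoint P (X 0) = γ) :
    ∀ᵐ ω ∂P, ∀ i, ⨆ n, V ω * X (i + n) ω = V ω * γ := by
  filter_upwards [hVpos, hXerg.ae_hasTailFrequencies hX,
    hXerg.ae_forall_le_rightEndpoint hX hγ] with ω hv hfreq hle i
  have hlub := isLUB_range_tail hle (fun r hr => hfreq.frequently_lt hr
    (measureReal_Ioi_pos_of_lt_rightEndpoint (hX 0) hγ)) i
  rw [← Real.mul_iSup_of_nonneg hv.le, hlub.ciSup_eq]

theorem ae_forall_ne_sub_div (hX : ∀ n, Measurable (X n)) (hV : Measurable V)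
    (hVpos : ∀ᵐ ω ∂P, 0 < V ω) (hXerg : IsStationaryErgodic P X)
    (hSstat : IsStrictlyStationary P fun n ω => V ω * X n ω) (hγ : rightEndpoint P (X 0) = γ)
    (hatom : ∀ᵐ ω ∂P, X 0 ω + a / V ω ≠ γ) : ∀ᵐ ω ∂P, ∀ i, X i ω ≠ γ - a / V ω := by
  have hsup := ae_iSup_scaled_tail hX hVpos hXerg hγ
  have hiff : ∀ {v : ℝ}, 0 < v → ∀ y, v * γ = v * y + a ↔ y = γ - a / v := fun {v} hv y => by
    constructor <;> intro h <;> field_simp at h ⊢ <;> linarith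
  have hne : ∀ᵐ ω ∂P, (⨆ n, V ω * X n ω) ≠ V ω * X 0 ω + a := by
    filter_upwards [hVpos, hsup, hatom] with ω hv hsup hne
    have hsup0 := hsup 0
    simp only [zero_add] at hsup0
    rwa [hsup0, Ne, hiff hv, eq_sub_iff_add_eq]
  -- The excluded event is expressed by the scaled sequence, so its stationarity applies.
  filter_upwards [hVpos, hsup, ae_all_iff.2 (hSstat.ae_shift (fun n => hV.mul (hX n))
    (p := fun s => (⨆ n, s n) ≠ s 0 + a) (measurableSet_eq_fun measurable_iSup_apply
      (by fun_prop)).compl hne)] with ω hv hsup hne i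
  simpa [hsup i, hiff hv] using hne i

theorem ae_map_singleton_sub_div_eq_zero (hX : ∀ n, Measurable (X n)) (hV : Measurable V)
    (hVpos : ∀ᵐ ω ∂P, 0 < V ω) (hXerg : IsStationaryErgodic P X)
    (hSstat : IsStrictlyStationary P fun n ω => V ω * X n ω) (hγ : rightEndpoint P (X 0) = γ)
    (hatom : ∀ᵐ ω ∂P, X 0 ω + a / V ω ≠ γ) :
    ∀ᵐ ω ∂P, P.map (X 0) {γ - a / V ω} = 0 := by
  -- `V` may depend on `X`, but every atom is visited, whereas `γ - a / V` almost surely is not.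
  filter_upwards [ae_forall_ne_sub_div hX hV hVpos hXerg hSstat hγ hatom,
    hXerg.ae_forall_atom_mem_range hX] with ω hne hvisit
  by_contra hpos
  obtain ⟨i, hi⟩ := hvisit _ hpos
  exact hne i hi

theorem ae_tendsto_birkhoffAverage_nearSup (hX : ∀ n, Measurable (X n)) (hV : Measurable V)
    (hVpos : ∀ᵐ ω ∂P, 0 < V ω) (hXerg : IsStationaryErgodic P X)
    (hSstat : IsStrictlyStationary P fun n ω => V ω * X n ω) (hγ : rightEndpoint P (X 0) = γ)
    (hatom : ∀ᵐ ω ∂P, X 0 ω + a / V ω ≠ γ) :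
    ∀ᵐ ω ∂P, Tendsto (fun n => birkhoffAverage ℝ seqShift ((nearSup a).indicator 1) n
      fun i => V ω * X i ω) atTop (𝓝 ((P.map (X 0)).real (Set.Ioi (γ - a / V ω)))) := by
  have : IsProbabilityMeasure (P.map (X 0)) :=
    Measure.isProbabilityMeasure_map (hX 0).aemeasurable
  filter_upwards [hVpos, hXerg.ae_hasTailFrequencies hX, ae_iSup_scaled_tail hX hVpos hXerg hγ,
    ae_map_singleton_sub_div_eq_zero hX hV hVpos hXerg hSstat hγ hatom] with ω hv hfreq hsup hnull
  refine (hfreq.tendsto_visitFreq_Ioi hnull tendsto_const_nhds).congr fun n => ?_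
  have hmem : ∀ i, (fun m => V ω * X (i + m) ω) ∈ nearSup a ↔ γ - a / V ω < X i ω := fun i =>
    mem_nearSup_const_mul_iff (x := (X · ω)) hv (hsup i)
  simp only [birkhoffAverage_indicator_one, seqShift_iterate, visitFreq, Set.mem_Ioi, hmem]

theorem scaledLimit_ae_eq (hX : ∀ n, Measurable (X n)) (hV : Measurable V)
    (hVpos : ∀ᵐ ω ∂P, 0 < V ω) (hXerg : IsStationaryErgodic P X)
    (hSstat : IsStrictlyStationary P fun n ω => V ω * X n ω) (hγ : rightEndpoint P (X 0) = γ)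
    (hatom : ∀ᵐ ω ∂P, X 0 ω + a / V ω ≠ γ) :
    scaledLimit P X V a =ᵐ[P] fun ω => (P.map (X 0)).real (Set.Ioi (γ - a / V ω)) := by
  have hevent : Set.indicator {ω | rightEndpoint P (X 0) < ((X 0 ω + a / V ω : ℝ) : EReal)}
      (fun _ => (1 : ℝ)) =ᵐ[P] fun ω => (nearSup a).indicator 1 fun i => V ω * X i ω := by
    filter_upwards [hVpos, ae_iSup_scaled_tail hX hVpos hXerg hγ] with ω hv hsup
    have hiff := mem_nearSup_const_mul_iff (x := (X · ω)) (a := a) hv (hsup 0)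
    simp only [zero_add] at hiff
    classical
    simp only [Set.indicator_apply, Set.mem_ofPred_eq, hiff, hγ, EReal.coe_lt_coe_iff,
      sub_lt_iff_lt_add, Pi.one_apply]
  have hbound : ∀ s, |(nearSup a).indicator (1 : (ℕ → ℝ) → ℝ) s| ≤ 1 := fun s => by
    simpa only [Pi.one_apply, norm_one, Real.norm_eq_abs] using
      norm_indicator_le_norm_self (s := nearSup a) (1 : (ℕ → ℝ) → ℝ) s
  exact (condExp_congr_ae hevent).trans (hSstat.condExp_ae_eq_of_tendsto_birkhoffAverage
    (fun n => hV.mul (hX n)) (measurable_one.indicator (measurableSet_nearSup a)) hbound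
    (ae_tendsto_birkhoffAverage_nearSup hX hV hVpos hXerg hSstat hγ hatom))

theorem ae_tendsto_nearCount_div_scaledLimit {k : ℕ → ℕ} (hX : ∀ n, Measurable (X n))
    (hV : Measurable V) (hVpos : ∀ᵐ ω ∂P, 0 < V ω) (hXerg : IsStationaryErgodic P X)
    (hSstat : IsStrictlyStationary P fun n ω => V ω * X n ω)
    (hk : ∀ n, 1 ≤ n → 1 ≤ k n ∧ k n ≤ n)
    (hklim : Tendsto (fun n => (k n : ℝ) / n) atTop (𝓝 1))
    (hγ : rightEndpoint P (X 0) < ⊤)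
    (hatom : P {ω | (X 0 ω : EReal) = rightEndpoint P (X 0)} = 0)
    (hatom' : P {ω | ((X 0 ω + a / V ω : ℝ) : EReal) = rightEndpoint P (X 0)} = 0) :
    ∀ᵐ ω ∂P, Tendsto (fun n : ℕ => (nearCount (fun i => V ω * X i ω) (k n) n a : ℝ) / n) atTop
      (𝓝 (scaledLimit P X V a ω)) := by
  have : IsProbabilityMeasure (P.map (X 0)) :=
    Measure.isProbabilityMeasure_map (hX 0).aemeasurable
  obtain ⟨γ, hγeq⟩ := exists_coe_eq_rightEndpoint (hX 0) hγ
  simp only [hγeq, EReal.coe_eq_coe_iff, measure_eq_zero_iff_ae_notMem, Set.mem_ofPred_eq]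
    at hatom hatom'
  filter_upwards [hVpos, hXerg.ae_hasTailFrequencies hX,
    hXerg.ae_forall_le_rightEndpoint hX hγeq,
    ae_map_singleton_sub_div_eq_zero hX hV hVpos hXerg hSstat hγeq hatom',
    scaledLimit_ae_eq hX hV hVpos hXerg hSstat hγeq hatom'] with ω hv hfreq hle hnull hlim
  have hord := hfreq.tendsto_orderStat hk hklim hle
    (measureReal_Ioi_pos_of_lt_rightEndpoint (hX 0) hγeq)
  simp only [hlim, nearCount_const_mul hv]
  exact hfreq.tendsto_nearCount_div hord (map_Ici_rightEndpoint_eq_zero (hX 0) hγeq hatom) hnull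

end ScaledSequence

section RandomIndex

theorem div_eq_natCast_div_mul {κ : ℕ → ℝ} (hκ0 : κ 0 = 0) (n : ℕ) (c : ℝ) :
    κ n / c = (n : ℝ) / c * (κ n / n) := by
  rcases eq_or_ne n 0 with rfl | hn
  · simp [hκ0]
  · field_simp

theorem tendsto_div_randomIndex {ι : Type*} {l : Filter ι} {κ : ℕ → ℝ} {N : ι → ℕ} {c : ι → ℝ}
    {z ℓ : ℝ} (hκ0 : κ 0 = 0) (hκ : Tendsto (fun n => κ n / n) atTop (𝓝 ℓ)) (hz : 0 < z)
    (hc : Tendsto c l atTop) (h : Tendsto (fun t => (N t : ℝ) / c t) l (𝓝 z)) :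
    Tendsto (fun t => κ (N t) / c t) l (𝓝 (z * ℓ)) := by
  have hN : Tendsto N l atTop := by
    rw [← tendsto_natCast_atTop_iff (R := ℝ)]
    refine (h.pos_mul_atTop hz hc).congr' ?_
    filter_upwards [hc.eventually_gt_atTop 0] with t ht using div_mul_cancel₀ _ ht.ne'
  exact (h.mul (hκ.comp hN)).congr fun t => (div_eq_natCast_div_mul hκ0 (N t) (c t)).symm

variable {Ω ι : Type*} [MeasurableSpace Ω] {P : Measure Ω} {l : Filter ι} {K : ℕ → Ω → ℝ}
  {L Z : Ω → ℝ} {N : ι → Ω → ℕ} {c : ι → ℝ}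

theorem measurable_randomIndex {M : Ω → ℕ} (hK : ∀ n, Measurable (K n)) (hM : Measurable M) :
    Measurable fun ω => K (M ω) ω :=
  (measurable_from_prod_countable_right (f := fun p : ℕ × Ω => K p.1 p.2) hK).comp
    (hM.prodMk measurable_id)

theorem measurable_randomIndex_div_natCast {M : Ω → ℕ} (hK : ∀ n, Measurable (K n))
    (hM : Measurable M) : Measurable fun ω => K (M ω) ω / M ω :=
  measurable_randomIndex (K := fun n ω => K n ω / n) (fun n => (hK n).div_const _) hM

theorem tendstoInMeasure_of_forall_exists_subseq [IsFiniteMeasure P] [l.IsCountablyGenerated]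
    {f : ι → Ω → ℝ} {g : Ω → ℝ} (hf : ∀ t, Measurable (f t))
    (h : ∀ ts : ℕ → ι, Tendsto ts atTop l → ∃ ms : ℕ → ℕ,
      ∀ᵐ ω ∂P, Tendsto (fun j => f (ts (ms j)) ω) atTop (𝓝 (g ω))) :
    TendstoInMeasure P f l g := by
  intro ε hε
  refine tendsto_of_subseq_tendsto fun ts hts => ?_
  obtain ⟨ms, hms⟩ := h ts hts
  exact ⟨ms, tendstoInMeasure_of_tendsto_ae (fun j => (hf _).aestronglyMeasurable) hms ε hε⟩

theorem tendstoInMeasure_div_randomIndex [IsFiniteMeasure P] [l.IsCountablyGenerated]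
    (hK : ∀ n, Measurable (K n)) (hK0 : ∀ ω, K 0 ω = 0)
    (hKL : ∀ᵐ ω ∂P, Tendsto (fun n => K n ω / n) atTop (𝓝 (L ω)))
    (hN : ∀ t, Measurable (N t)) (hZpos : ∀ᵐ ω ∂P, 0 < Z ω) (hc : Tendsto c l atTop)
    (h : TendstoInMeasure P (fun t ω => (N t ω : ℝ) / c t) l Z) :
    TendstoInMeasure P (fun t ω => K (N t ω) ω / c t) l fun ω => Z ω * L ω := by
  refine tendstoInMeasure_of_forall_exists_subseq
    (fun t => (measurable_randomIndex hK (hN t)).div_const _) fun ts hts => ?_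
  obtain ⟨ms, hms, hlim⟩ := (h.comp hts).exists_seq_tendsto_ae
  refine ⟨ms, ?_⟩
  filter_upwards [hKL, hZpos, hlim] with ω hKω hz hω
  exact tendsto_div_randomIndex (κ := (K · ω)) (hK0 ω) hKω hz
    (hc.comp (hts.comp hms.tendsto_atTop)) hω

theorem exists_pos_map_Iic_lt [IsProbabilityMeasure P] (hZ : Measurable Z)
    (hZpos : ∀ᵐ ω ∂P, 0 < Z ω) {η : ENNReal} (hη : 0 < η) :
    ∃ δ > 0, P.map Z (Set.Iic δ) < η := by
  have : IsProbabilityMeasure (P.map Z) := Measure.isProbabilityMeasure_map hZ.aemeasurable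
  have hzero : P.map Z (Set.Iic 0) = 0 := by
    rw [Measure.map_apply hZ measurableSet_Iic, measure_eq_zero_iff_ae_notMem]
    filter_upwards [hZpos] with ω hω using not_le.2 hω
  have hright : Tendsto (fun δ => P.map Z (Set.Iic δ)) (𝓝[>] 0) (𝓝 0) := by
    simp only [← hzero, ← ofReal_cdf]
    exact ENNReal.tendsto_ofReal
      (((cdf (P.map Z)).right_continuous 0).mono Set.Ioi_subset_Ici_self)
  exact ((hright.eventually_lt_const hη).and self_mem_nhdsWithin).exists.imp fun _ => And.symm

theorem tendsto_measure_le_of_tendstoInDistribution_div [IsProbabilityMeasure P]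
    {Y : ι → Ω → ℝ} (hY : ∀ t, Measurable (Y t)) (hZ : Measurable Z)
    (hZpos : ∀ᵐ ω ∂P, 0 < Z ω) (hc : Tendsto c l atTop)
    (h : TendstoInDistribution (fun t ω => Y t ω / c t) l Z (fun _ => P) P) (m : ℝ) :
    Tendsto (fun t => P {ω | Y t ω ≤ m}) l (𝓝 0) := by
  refine ENNReal.tendsto_nhds_zero.2 fun η hη => ?_
  obtain ⟨δ, hδ, hPδ⟩ := exists_pos_map_Iic_lt hZ hZpos hη
  have hlimsup := ProbabilityMeasure.limsup_measure_closed_le_of_tendsto h.tendsto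
    (isClosed_Iic (a := δ))
  filter_upwards [eventually_lt_of_limsup_lt (hlimsup.trans_lt hPδ), hc.eventually_gt_atTop 0,
    hc.eventually_ge_atTop (m / δ)] with t ht hct hmt
  rw [ProbabilityMeasure.coe_mk, Measure.map_apply ((hY t).div_const _) measurableSet_Iic] at ht
  refine (measure_mono fun ω hω => ?_).trans ht.le
  rw [div_le_iff₀ hδ, mul_comm] at hmt
  exact (div_le_iff₀ hct).2 (hω.trans hmt)

-- Divergence of `N t` in probability, in a form that yields a.s. divergence along subsequences.
theorem tendstoInMeasure_inv_natCast_add_one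
    (h : ∀ m : ℝ, Tendsto (fun t => P {ω | (N t ω : ℝ) ≤ m}) l (𝓝 0)) :
    TendstoInMeasure P (fun t ω => ((N t ω : ℝ) + 1)⁻¹) l fun _ => 0 := by
  refine tendstoInMeasure_iff_norm.2 fun ε hε => ?_
  refine tendsto_of_tendsto_of_tendsto_of_le_of_le tendsto_const_nhds (h ε⁻¹)
    (fun _ => zero_le) fun t => measure_mono fun ω hω => ?_
  have hpos : (0 : ℝ) < (N t ω : ℝ) + 1 := by positivity
  rw [Set.mem_ofPred_eq, sub_zero, Real.norm_of_nonneg (inv_nonneg.2 hpos.le),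
    le_inv_comm₀ hε hpos] at hω
  exact (le_add_of_nonneg_right zero_le_one).trans hω

theorem tendstoInMeasure_randomIndex [IsFiniteMeasure P] [l.IsCountablyGenerated]
    {R : ℕ → Ω → ℝ} (hR : ∀ n, Measurable (R n)) (hN : ∀ t, Measurable (N t))
    (hRL : ∀ᵐ ω ∂P, Tendsto (fun n => R n ω) atTop (𝓝 (L ω)))
    (h : TendstoInMeasure P (fun t ω => ((N t ω : ℝ) + 1)⁻¹) l fun _ => 0) :
    TendstoInMeasure P (fun t ω => R (N t ω) ω) l L := by
  refine tendstoInMeasure_of_forall_exists_subseq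
    (fun t => measurable_randomIndex hR (hN t)) fun ts hts => ?_
  obtain ⟨ms, -, hms⟩ := (h.comp hts).exists_seq_tendsto_ae
  refine ⟨ms, ?_⟩
  filter_upwards [hRL, hms] with ω hω hinv
  refine hω.comp (f := fun j => N (ts (ms j)) ω) ?_
  have hpos : Tendsto (fun j => ((N (ts (ms j)) ω : ℝ) + 1)⁻¹) atTop (𝓝[>] 0) :=
    tendsto_nhdsWithin_iff.2 ⟨hinv, Eventually.of_forall fun j => Set.mem_Ioi.2 (by positivity)⟩
  rw [← tendsto_natCast_atTop_iff (R := ℝ)]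
  simpa using tendsto_atTop_add_const_right _ (-1) hpos.inv_tendsto_nhdsGT_zero

theorem tendstoInDistribution_div_randomIndex [IsProbabilityMeasure P] [l.IsCountablyGenerated]
    (hK : ∀ n, Measurable (K n)) (hK0 : ∀ ω, K 0 ω = 0)
    (hKL : ∀ᵐ ω ∂P, Tendsto (fun n => K n ω / n) atTop (𝓝 (L ω))) (hL : IsDegenerate P L)
    (hN : ∀ t, Measurable (N t)) (hZ : Measurable Z) (hZpos : ∀ᵐ ω ∂P, 0 < Z ω)
    (hc : Tendsto c l atTop)
    (h : TendstoInDistribution (fun t ω => (N t ω : ℝ) / c t) l Z (fun _ => P) P) :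
    TendstoInDistribution (fun t ω => K (N t ω) ω / c t) l (fun ω => Z ω * L ω)
      (fun _ => P) P := by
  obtain ⟨q, hq⟩ := hL
  have hNtop := tendsto_measure_le_of_tendstoInDistribution_div
    (fun t => measurable_from_top.comp (hN t)) hZ hZpos hc h
  have hratio : TendstoInMeasure P (fun t ω => K (N t ω) ω / N t ω) l fun _ => q :=
    (tendstoInMeasure_randomIndex (fun n => (hK n).div_const n) hN hKL
      (tendstoInMeasure_inv_natCast_add_one hNtop)).congr_right hq
  have hprod := h.continuous_comp_prodMk_of_tendstoInMeasure_const
    (g := fun p : ℝ × ℝ => p.1 * p.2) (by fun_prop) hratio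
    fun t => (measurable_randomIndex_div_natCast hK (hN t)).aemeasurable
  refine hprod.congr (fun t => ae_of_all _ fun ω => ?_) ?_
  · exact (div_eq_natCast_div_mul (κ := (K · ω)) (hK0 ω) (N t ω) (c t)).symm
  · filter_upwards [hq] with ω hω
    rw [hω]

end RandomIndex

theorem theorem5p4_general {Ω ι : Type*} [MeasurableSpace Ω] {P : Measure Ω}
    [IsProbabilityMeasure P] {l : Filter ι} [l.IsCountablyGenerated] {X : ℕ → Ω → ℝ} {V : Ω → ℝ}
    {k : ℕ → ℕ} {a : ℝ} (hX : ∀ n, Measurable (X n)) (hV : Measurable V)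
    (hVpos : ∀ᵐ ω ∂P, 0 < V ω) (hXerg : IsStationaryErgodic P X)
    (hSstat : IsStrictlyStationary P fun n ω => V ω * X n ω)
    (hk : ∀ n, 1 ≤ n → 1 ≤ k n ∧ k n ≤ n)
    (hklim : Tendsto (fun n => (k n : ℝ) / n) atTop (𝓝 1))
    (hγ : rightEndpoint P (X 0) < ⊤)
    (hatom : P {ω | (X 0 ω : EReal) = rightEndpoint P (X 0)} = 0)
    (hatom' : P {ω | ((X 0 ω + a / V ω : ℝ) : EReal) = rightEndpoint P (X 0)} = 0) :
    (∀ᵐ ω ∂P, Tendsto (fun n : ℕ => (nearCount (fun i => V ω * X i ω) (k n) n a : ℝ) / n) atTop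
      (𝓝 (scaledLimit P X V a ω))) ∧
    (∀ (N : ι → Ω → ℕ) (Z : Ω → ℝ) (c : ι → ℝ),
      (∀ t, Measurable (N t)) → Measurable Z → (∀ᵐ ω ∂P, 0 < Z ω) → Tendsto c l atTop →
      ((∀ᵐ ω ∂P, Tendsto (fun t => (N t ω : ℝ) / c t) l (𝓝 (Z ω))) →
        ∀ᵐ ω ∂P, Tendsto
          (fun t => (nearCount (fun i => V ω * X i ω) (k (N t ω)) (N t ω) a : ℝ) / c t) l
          (𝓝 (Z ω * scaledLimit P X V a ω))) ∧
      (TendstoInMeasure P (fun t ω => (N t ω : ℝ) / c t) l Z →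
        TendstoInMeasure P
          (fun t ω => (nearCount (fun i => V ω * X i ω) (k (N t ω)) (N t ω) a : ℝ) / c t) l
          (fun ω => Z ω * scaledLimit P X V a ω)) ∧
      (TendstoInDistribution (fun t ω => (N t ω : ℝ) / c t) l Z (fun _ => P) P →
        IsDegenerate P (scaledLimit P X V a) →
        TendstoInDistribution
          (fun t ω => (nearCount (fun i => V ω * X i ω) (k (N t ω)) (N t ω) a : ℝ) / c t) l
          (fun ω => Z ω * scaledLimit P X V a ω) (fun _ => P) P)) := by
  have hlim := ae_tendsto_nearCount_div_scaledLimit hX hV hVpos hXerg hSstat hk hklim hγ hatom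
    hatom'
  have hS : Measurable fun ω n => V ω * X n ω := measurable_pi_lambda _ fun n => hV.mul (hX n)
  let K : ℕ → Ω → ℝ := fun n ω => nearCount (fun i => V ω * X i ω) (k n) n a
  have hK : ∀ n, Measurable (K n) := fun n =>
    measurable_from_top.comp ((measurable_nearCount (k n) n a).comp hS)
  have hK0 : ∀ ω, K 0 ω = 0 := fun ω => by simp [K, nearCount]
  refine ⟨hlim, fun N Z c hN hZ hZpos hc => ⟨fun h => ?_, fun h => ?_, fun h hL => ?_⟩⟩
  · filter_upwards [hlim, hZpos, h] with ω hω hz hNω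
    exact tendsto_div_randomIndex (κ := (K · ω)) (hK0 ω) hω hz hc hNω
  · exact tendstoInMeasure_div_randomIndex (K := K) hK hK0 hlim hN hZpos hc h
  · exact tendstoInDistribution_div_randomIndex (K := K) hK hK0 hlim hL hN hZ hZpos hc h

theorem theorem5p4 {Ω : Type*} [MeasurableSpace Ω] (P : Measure Ω) [IsProbabilityMeasure P]
    (X : ℕ → Ω → ℝ) (V : Ω → ℝ) (S : ℕ → Ω → ℝ) (k : ℕ → ℕ) (a : ℝ)
    (hX : ∀ n, Measurable (X n)) (hV : Measurable V)
    (hVpos : ∀ᵐ ω ∂P, 0 < V ω)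
    (hXerg : IsStationaryErgodic P X)
    (hS : S = fun n ω => V ω * X n ω)
    (hSstat : IsStrictlyStationary P S)
    (ha : 0 < a)
    (hk : ∀ n, 1 ≤ n → 1 ≤ k n ∧ k n ≤ n)
    (hklim : Tendsto (fun n => (k n : ℝ) / n) atTop (𝓝 1))
    (hγ : rightEndpoint P (X 0) < ⊤)
    (hatom : P {ω | (X 0 ω : EReal) = rightEndpoint P (X 0)} = 0)
    (hatom' : P {ω | ((X 0 ω + a / V ω : ℝ) : EReal) = rightEndpoint P (X 0)} = 0) :
    (∀ᵐ ω ∂P, Tendsto (fun n : ℕ => (nearCount (fun i => S i ω) (k n) n a : ℝ) / n) atTop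
      (𝓝 (scaledLimit P X V a ω))) ∧
    (∀ (N : ℝ≥0 → Ω → ℕ) (Z : Ω → ℝ) (c : ℝ≥0 → ℝ),
      (∀ t, Measurable (N t)) → Measurable Z → (∀ᵐ ω ∂P, 0 < Z ω) →
      (∀ t, 0 < t → 0 < c t) → Tendsto c atTop atTop →
      ((∀ᵐ ω ∂P, Tendsto (fun t => (N t ω : ℝ) / c t) atTop (𝓝 (Z ω))) →
        ∀ᵐ ω ∂P, Tendsto
          (fun t => (nearCount (fun i => S i ω) (k (N t ω)) (N t ω) a : ℝ) / c t) atTop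
          (𝓝 (Z ω * scaledLimit P X V a ω))) ∧
      (TendstoInMeasure P (fun t ω => (N t ω : ℝ) / c t) atTop Z →
        TendstoInMeasure P
          (fun t ω => (nearCount (fun i => S i ω) (k (N t ω)) (N t ω) a : ℝ) / c t) atTop
          (fun ω => Z ω * scaledLimit P X V a ω)) ∧
      (TendstoInDistribution (fun t ω => (N t ω : ℝ) / c t) atTop Z (fun _ => P) P →
        IsDegenerate P (scaledLimit P X V a) →
        TendstoInDistribution
          (fun t ω => (nearCount (fun i => S i ω) (k (N t ω)) (N t ω) a : ℝ) / c t) atTop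
          (fun ω => Z ω * scaledLimit P X V a ω) (fun _ => P) P)) := by
  subst hS
  obtain ⟨hlim, hrandom⟩ := theorem5p4_general (ι := ℝ≥0) (l := atTop) hX hV hVpos hXerg hSstat
    hk hklim hγ hatom hatom'
  exact ⟨hlim, fun N Z c hN hZ hZpos _ => hrandom N Z c hN hZ hZpos⟩
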